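/- All rings are commutative with nonzero identity and all ring homomorphisms are unital. An injective ring homomorphism $f\colon R\hookrightarrow T$ that is not an isomorphism is called minimal if there is no ring strictly between $R$ and $T$, i.e. for every factorization $f=g\circ h$ with $h\colon R\to S$ and $g\colon S\to T$ ring homomorphisms and $g$ injective, one of $g,h$ is an isomorphism. For a prime ideal $P$ of $R$ write $T_P:=T_{R\setminus P}$. The crucial maximal ideal of a minimal ring homomorphism $R\hookrightarrow T$ is the (unique) maximal ideal $J$ of $R$ for which $R_J\hookrightarrow T_J$ is not an isomorphism. For a ring extension $A\subseteq B$ let $(A:B):=\{b\in B : bB\subseteq A\}$, which is an ideal of both $A$ and $B$. Theorem. Let $R\hookrightarrow T$ be a minimal ring homomorphism with crucial maximal ideal $J$. Then $R\hookrightarrow T$ is a flat epimorphism (that is, $T$ is a flat $R$-module and $R\hookrightarrow T$ is an epimorphism of commutative rings) if and only if $R_J/(R_J:T_J)$ is a one-dimensional valuation ring (a valuation domain of Krull dimension one) and $T_J/(R_J:T_J)$ is its quotient field, via the homomorphism $R_J/(R_J:T_J)\to T_J/(R_J:T_J)$ induced by $R_J\hookrightarrow T_J$. -/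

import Mathlib

universe u v

namespace MinimalRingHom

/-- A ring homomorphism `f : R → T` is *minimal* if it is injective, not an isomorphism, and for
every factorization `f = g ∘ h` through a ring `S` which lies between `R` and `T` (that is, `g` is
injective; `h` is then injective because `f` is), one of `g`, `h` is an isomorphism. Since `S`
embeds in `T`, rings in the universe of `T` suffice. -/
structure IsMinimal {R : Type u} {T : Type v} [CommRing R] [CommRing T] (f : R →+* T) : Prop where
  injective : Function.Injective f
  not_bijective : ¬ Function.Bijective f
  factor : ∀ (S : Type v) [CommRing S] (h : R →+* S) (g : S →+* T), Function.Injective g →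
    g.comp h = f → Function.Bijective g ∨ Function.Bijective h

/-- `f : R → T` is an epimorphism of commutative rings: it is right cancellable. Two homomorphisms
out of `T` take values in the subring generated by the two images, so test rings `S` in the
universe of `T` suffice. -/
def IsEpimorphism {R : Type u} {T : Type v} [CommRing R] [CommRing T] (f : R →+* T) : Prop :=
  ∀ (S : Type v) [CommRing S] (g h : T →+* S), g.comp f = h.comp f → g = h

/-- `f : R → T` is a flat epimorphism. -/
def IsFlatEpimorphism {R : Type u} {T : Type v} [CommRing R] [CommRing T] (f : R →+* T) : Prop :=
  f.Flat ∧ IsEpimorphism f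

/-- `T_J`, the localization of `T` at (the image of) `R ∖ J`. -/
abbrev TLocalization {R : Type u} {T : Type v} [CommRing R] [CommRing T] (f : R →+* T)
    (J : Ideal R) [J.IsPrime] : Type v :=
  Localization (J.primeCompl.map f)

/-- The homomorphism `R_J → T_J` induced by `f : R → T`. -/
noncomputable def localizedHom {R : Type u} {T : Type v} [CommRing R] [CommRing T] (f : R →+* T)
    (J : Ideal R) [J.IsPrime] : Localization.AtPrime J →+* TLocalization f J :=
  IsLocalization.map (TLocalization f J) f J.primeCompl.le_comap_map

/-- The maximal ideal `J` of `R` is crucial for `f : R → T` if `R_J → T_J` is not an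
isomorphism. -/
def IsCrucial {R : Type u} {T : Type v} [CommRing R] [CommRing T] (f : R →+* T)
    (J : Ideal R) [J.IsMaximal] : Prop :=
  ¬ Function.Bijective (localizedHom f J)

/-- The conductor `(A : B) = {b ∈ B | b B ⊆ A}` of `f : A → B`, as an ideal of `B`, where `A` is
identified with its image in `B`. -/
def conductor {A : Type u} {B : Type v} [CommRing A] [CommRing B] (f : A →+* B) : Ideal B where
  carrier := {b | ∀ x : B, b * x ∈ f.range}
  zero_mem' := fun x => by rw [zero_mul]; exact f.range.zero_mem
  add_mem' := fun {a b} ha hb x => by rw [add_mul]; exact f.range.add_mem (ha x) (hb x)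
  smul_mem' := fun c b hb x => by
    have h := hb (c * x)
    rwa [show c • b * x = b * (c * x) by rw [smul_eq_mul]; ring]

/-- The conductor `(A : B)` as an ideal of `A`. -/
def conductorBelow {A : Type u} {B : Type v} [CommRing A] [CommRing B] (f : A →+* B) : Ideal A :=
  (conductor f).comap f

/-- The homomorphism `A / (A : B) → B / (A : B)` induced by `f : A → B`. -/
def conductorQuotientHom {A : Type u} {B : Type v} [CommRing A] [CommRing B] (f : A →+* B) :
    A ⧸ conductorBelow f →+* B ⧸ conductor f :=
  Ideal.quotientMap (conductor f) f le_rfl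

/-- `D` is a one-dimensional valuation ring: a valuation domain of Krull dimension one. -/
def IsOneDimValuationRing (D : Type u) [CommRing D] : Prop :=
  (∃ _ : IsDomain D, ValuationRing D) ∧ ringKrullDim D = 1

/-- `K` is the quotient field of `D` through the homomorphism `i : D → K`. -/
def IsQuotientField {D : Type u} {K : Type v} [CommRing D] [CommRing K] (i : D →+* K) : Prop :=
  letI : Algebra D K := i.toAlgebra
  IsDomain D ∧ IsFractionRing D K

end MinimalRingHom

/-! Pass to `D = R_J/(R_J:T_J)` inside `E = T_J/(R_J:T_J)`: `D` is local, no nonzero element of `D`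
multiplies `E` into `D`, and no ring lies strictly between. If `D → E` is an epimorphism, `D` is not
a field. For a nonzero ideal `I`, the ring `D + IE` is not `D`, hence is `E`; so `D` is a domain and
`E = D + 𝔪E`. Nakayama makes `D` integrally closed in `E`, and then each `t` in `E` has `t` or `t⁻¹`
in `D` (`mem_range_or_inv`). Every nonzero element of `D` becomes a unit of `E`
(`isUnit_algebraMap`), so `D` is a valuation ring with quotient field `E`. Its dimension is one
because `E = D[1/z]` for every nonzero nonunit `z`. Conversely, if `E` is the quotient field of `D`,
then `T_J` is the localization of `R_J` at the prime `(R_J:T_J)`. At any other maximal ideal the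
localized map is an isomorphism (`IsCrucial.eq_of_isQuotientField`), and flat epimorphisms are
detected locally. -/

namespace MinimalRingHom

open Polynomial TensorProduct

/-! ### Minimal epimorphisms with zero conductor -/

section LocalDomain

variable {D : Type u} {E : Type v} [CommRing D] [CommRing E] [Algebra D E]

/-- An epimorphism whose source is a field and whose target is nonzero is surjective. -/
theorem surjective_algebraMap_of_isEpi_of_isField (hD : IsField D) [Nontrivial E]
    [Algebra.IsEpi D E] : Function.Surjective (algebraMap D E) := by
  let := hD.toField
  intro e
  have he : e ∈ AlgHom.equalizer (Algebra.TensorProduct.includeLeft : E →ₐ[D] E ⊗[D] E)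
      Algebra.TensorProduct.includeRight :=
    ((Algebra.isEpi_iff_forall_one_tmul_eq D E).mp inferInstance e).symm
  -- Over a field `E` is faithfully flat, so by descent the elements with `e ⊗ 1 = 1 ⊗ e` are
  -- exactly those of `D`.
  have := Algebra.IsEffective.eqLocus_includeLeft_includeRight
    (Algebra.IsEffective.of_faithfullyFlat D E)
  have he' : e ∈ Set.range (algebraMap D E) := by
    rw [← this]; exact he
  exact he'

/-- The subring `D + IE` of `E`, for an ideal `I` of `D`. -/
def addIdeal (E : Type v) [CommRing E] [Algebra D E] (I : Ideal D) : Subalgebra D E where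
  carrier := {e | ∃ a : D, e - algebraMap D E a ∈ I.map (algebraMap D E)}
  mul_mem' := by
    rintro x y ⟨a, ha⟩ ⟨b, hb⟩
    refine ⟨a * b, ?_⟩
    have : x * y - algebraMap D E (a * b) =
        (x - algebraMap D E a) * y + algebraMap D E a * (y - algebraMap D E b) := by
      rw [map_mul]; ring
    rw [this]
    exact add_mem (Ideal.mul_mem_right _ _ ha) (Ideal.mul_mem_left _ _ hb)
  add_mem' := by
    rintro x y ⟨a, ha⟩ ⟨b, hb⟩
    refine ⟨a + b, ?_⟩
    have : x + y - algebraMap D E (a + b) =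
        (x - algebraMap D E a) + (y - algebraMap D E b) := by
      rw [map_add]; ring
    rw [this]
    exact add_mem ha hb
  algebraMap_mem' := fun r => ⟨r, by simp⟩

variable [IsSimpleOrder (Subalgebra D E)]

theorem exists_notMem_range : ∃ t : E, t ∉ (algebraMap D E).range := by
  by_contra! h
  exact bot_ne_top (α := Subalgebra D E)
    (Algebra.eq_top_iff.mpr fun t => Algebra.mem_bot.mpr (h t))

theorem nontrivial_of_isSimpleOrder (D : Type u) (E : Type v) [CommRing D] [CommRing E]
    [Algebra D E] [IsSimpleOrder (Subalgebra D E)] : Nontrivial E := by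
  obtain ⟨t, ht⟩ := exists_notMem_range (D := D) (E := E)
  exact ⟨t, 0, fun h => ht (h ▸ zero_mem _)⟩

/-- The conductor of `D → E` vanishes. -/
def ConductorFree (D : Type u) (E : Type v) [CommRing D] [CommRing E] [Algebra D E] : Prop :=
  ∀ x : D, (∀ e : E, algebraMap D E x * e ∈ (algebraMap D E).range) → x = 0

theorem addIdeal_eq_top (hc : ConductorFree D E) {I : Ideal D} (hI : I ≠ ⊥) :
    addIdeal E I = ⊤ := by
  refine (eq_bot_or_eq_top (addIdeal E I)).resolve_left fun h => hI ?_
  refine (Submodule.eq_bot_iff _).mpr fun x hx => hc x fun e => ?_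
  have : algebraMap D E x * e ∈ addIdeal E I :=
    ⟨0, by simpa using Ideal.mul_mem_right _ _ (Ideal.mem_map_of_mem _ hx)⟩
  rw [h] at this
  exact Algebra.mem_bot.mp this

theorem exists_eq_add_mul (hc : ConductorFree D E) {x : D} (hx : x ≠ 0) (e : E) :
    ∃ (a : D) (b : E), e = algebraMap D E a + algebraMap D E x * b := by
  have h := addIdeal_eq_top (E := E) hc (I := Ideal.span {x}) (by simpa using hx)
  obtain ⟨a, ha⟩ : e ∈ addIdeal E (Ideal.span {x}) := h ▸ Algebra.mem_top
  rw [Ideal.map_span, Set.image_singleton, Ideal.mem_span_singleton'] at ha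
  obtain ⟨b, hb⟩ := ha
  exact ⟨a, b, by rw [mul_comm, hb]; ring⟩

/-- If `xy = 0` with `x ≠ 0`, then `E = D + xE` gives `yE = yD`, so `y` lies in the conductor. -/
theorem isDomain_of_conductorFree (hc : ConductorFree D E) : IsDomain D := by
  have := nontrivial_of_isSimpleOrder D E
  have : Nontrivial D := (algebraMap D E).domain_nontrivial
  have : NoZeroDivisors D := ⟨fun {x y} hxy => by
    by_contra! h
    refine h.2 (hc y fun e => ?_)
    obtain ⟨a, b, rfl⟩ := exists_eq_add_mul hc h.1 e
    refine ⟨y * a, ?_⟩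
    have : algebraMap D E y * algebraMap D E x = 0 := by
      rw [← map_mul, mul_comm, hxy, map_zero]
    rw [map_mul, mul_add, ← mul_assoc, this, zero_mul, add_zero]⟩
  exact NoZeroDivisors.to_isDomain D

theorem not_isField_of_isEpi [Algebra.IsEpi D E] : ¬ IsField D := by
  intro hD
  have := nontrivial_of_isSimpleOrder D E
  obtain ⟨t, ht⟩ := exists_notMem_range (D := D) (E := E)
  exact ht (surjective_algebraMap_of_isEpi_of_isField hD t)

/-! ### Local source: integral closedness, inverses, dimension -/

variable [IsLocalRing D]

open IsLocalRing

/-- An integral `t` outside `D` would make `E = D[t]` a finite module, and `E = D + 𝔪E` would force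
`E = D` by Nakayama. -/
theorem mem_range_of_isIntegral (h : addIdeal E (maximalIdeal D) = ⊤) {t : E}
    (ht : IsIntegral D t) : t ∈ (algebraMap D E).range := by
  by_contra hn
  have htop : Algebra.adjoin D {t} = ⊤ := by
    refine (eq_bot_or_eq_top _).resolve_left fun hb => hn ?_
    exact Algebra.mem_bot.mp (hb ▸ Algebra.self_mem_adjoin_singleton D t)
  have hfg : (⊤ : Submodule D E).FG := by
    have := ht.fg_adjoin_singleton
    rwa [htop, Algebra.top_toSubmodule] at this
  have hle : (⊤ : Submodule D E) ≤ LinearMap.range (Algebra.linearMap D E) :=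
    Submodule.le_of_le_smul_of_le_jacobson_bot hfg
      (IsLocalRing.jacobson_eq_maximalIdeal ⊥ bot_ne_top).ge <| by
      intro e _
      obtain ⟨a, ha⟩ : e ∈ addIdeal E (maximalIdeal D) := h ▸ Algebra.mem_top
      rw [show e = algebraMap D E a + (e - algebraMap D E a) by ring]
      refine Submodule.add_mem_sup ⟨a, rfl⟩ ?_
      rw [Ideal.smul_top_eq_map]
      exact ha
  obtain ⟨a, ha⟩ := hle (Submodule.mem_top (x := t))
  exact hn ⟨a, ha⟩

/-- If `D` is integrally closed in `E` and `t ∈ D + 𝔪[t]`, then `t` or `t⁻¹` lies in `D`. -/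
theorem mem_range_or_exists_mul_eq_one (h : addIdeal E (maximalIdeal D) = ⊤) {t : E} (n : ℕ)
    (a : D) (p : D[X]) (hn : p.natDegree ≤ n) (hp : ∀ i, p.coeff i ∈ maximalIdeal D)
    (ht : t = algebraMap D E a + aeval t p) :
    t ∈ (algebraMap D E).range ∨ ∃ x : D, algebraMap D E x * t = 1 := by
  induction n generalizing p with
  | zero =>
    left
    rw [Polynomial.eq_C_of_natDegree_le_zero hn, aeval_C, ← map_add] at ht
    exact ⟨_, ht.symm⟩
  | succ n ih =>
    by_cases hlt : p.natDegree ≤ n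
    · exact ih p hlt hp ht
    have hdeg : p.natDegree = n + 1 := by omega
    -- Degree one is separate: the term `-X` of `p + a - X` would then alter the leading
    -- coefficient. Here the relation is linear in `t`, with unit coefficient `1 - p.coeff 1`.
    obtain rfl | hn0 := Nat.eq_zero_or_pos n
    · left
      rw [Polynomial.eq_X_add_C_of_natDegree_le_one hn] at ht
      simp only [map_add, map_mul, aeval_C, aeval_X] at ht
      have hu : IsUnit (1 - p.coeff 1) := by
        by_contra hu
        refine (maximalIdeal.isMaximal D).ne_top ((Ideal.eq_top_iff_one _).mpr ?_)
        simpa using add_mem ((mem_maximalIdeal _).mpr hu) (hp 1)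
      obtain ⟨w, hw⟩ := hu.exists_left_inv
      refine ⟨w * (a + p.coeff 0), ?_⟩
      have hw' := congrArg (algebraMap D E) hw
      simp only [map_mul, map_sub, map_one, map_add] at hw' ⊢
      linear_combination t * hw' - algebraMap D E w * ht
    · set c := p.coeff (n + 1) with hc
      -- `t` is a root of `p + a - X`, whose leading coefficient is `c`, so `ct` is integral.
      obtain ⟨d, hd⟩ : algebraMap D E c * t ∈ (algebraMap D E).range := by
        refine mem_range_of_isIntegral h ?_
        have hq : aeval t (p + (C a - X)) = 0 := by
          simp only [map_add, map_sub, aeval_C, aeval_X]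
          linear_combination -ht
        have hlt' : (C a - X).degree < p.degree := by
          have : (C a - X).natDegree ≤ 1 := by
            refine (natDegree_sub_le _ _).trans ?_
            simp
          exact degree_lt_degree (by omega)
        have := isIntegral_leadingCoeff_smul _ _ hq
        rwa [leadingCoeff_add_of_degree_lt' hlt', leadingCoeff, hdeg, Algebra.smul_def] at this
      by_cases hu : IsUnit d
      · obtain ⟨w, hw⟩ := hu.exists_left_inv
        refine Or.inr ⟨w * c, ?_⟩
        rw [map_mul, mul_assoc, ← hd, ← map_mul, hw, map_one]
      -- Since `ct = d` with `d ∈ 𝔪`, the top term `ct^(n+1)` may be replaced by `dt^n`.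
      · refine ih (p - C c * X ^ (n + 1) + C d * X ^ n) ?_ ?_ ?_
        · rw [natDegree_le_iff_coeff_eq_zero]
          intro N hN
          simp only [coeff_add, coeff_sub, coeff_C_mul, coeff_X_pow]
          obtain rfl | hN' := eq_or_ne N (n + 1)
          · simp [hc]
          · rw [coeff_eq_zero_of_natDegree_lt (by omega)]
            simp [hN', hN.ne']
        · intro i
          simp only [coeff_add, coeff_sub, coeff_C_mul]
          exact add_mem (sub_mem (hp i) (Ideal.mul_mem_right _ _ (hp _)))
            (Ideal.mul_mem_right _ _ ((mem_maximalIdeal _).mpr hu))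
        · simp only [map_add, map_sub, map_mul, map_pow, aeval_C, aeval_X]
          linear_combination ht - t ^ n * hd

theorem mem_range_or_inv (h : addIdeal E (maximalIdeal D) = ⊤) (t : E) :
    t ∈ (algebraMap D E).range ∨ ∃ x : D, algebraMap D E x * t = 1 := by
  by_cases hn : t ∈ (algebraMap D E).range
  · exact Or.inl hn
  have htop : Algebra.adjoin D {t} = ⊤ := by
    refine (eq_bot_or_eq_top _).resolve_left fun hb => hn ?_
    exact Algebra.mem_bot.mp (hb ▸ Algebra.self_mem_adjoin_singleton D t)
  obtain ⟨a, ha⟩ : t ∈ addIdeal E (maximalIdeal D) := h ▸ Algebra.mem_top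
  -- As `E = D[t]`, elements of `𝔪E` are polynomials in `t` with coefficients in `𝔪`.
  have key : ∀ y ∈ (maximalIdeal D).map (algebraMap D E),
      ∃ p : D[X], (∀ i, p.coeff i ∈ maximalIdeal D) ∧ aeval t p = y := by
    intro y hy
    refine Submodule.span_induction ?_ ?_ ?_ ?_ hy
    · rintro _ ⟨x, hx, rfl⟩
      refine ⟨C x, fun i => ?_, aeval_C _ _⟩
      rw [coeff_C]
      split_ifs
      exacts [hx, zero_mem _]
    · exact ⟨0, by simp, by simp⟩
    · rintro x y - - ⟨p, hp, rfl⟩ ⟨q, hq, rfl⟩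
      exact ⟨p + q, fun i => by rw [coeff_add]; exact add_mem (hp i) (hq i), map_add _ _ _⟩
    · rintro e y - ⟨p, hp, rfl⟩
      obtain ⟨q, rfl⟩ : e ∈ (aeval t : D[X] →ₐ[D] E).range := by
        rw [← Algebra.adjoin_singleton_eq_range_aeval, htop]; exact Algebra.mem_top
      refine ⟨q * p, fun i => ?_, map_mul _ _ _⟩
      rw [coeff_mul]
      exact sum_mem fun x _ => Ideal.mul_mem_left _ _ (hp _)
  obtain ⟨p, hp, hpa⟩ := key _ ha
  exact mem_range_or_exists_mul_eq_one h _ a p le_rfl hp (by rw [hpa]; ring)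

theorem addIdeal_maximalIdeal_eq_top [Algebra.IsEpi D E] (hc : ConductorFree D E) :
    addIdeal E (maximalIdeal D) = ⊤ :=
  addIdeal_eq_top hc fun h =>
    not_isField_of_isEpi (E := E) (IsLocalRing.isField_iff_maximalIdeal_eq.mpr h)

/-- Take `t` outside `D` with inverse `x ∈ 𝔪`, and write `t = a + ye`. Then `ye = t - a = (1 - ax)t`
is a unit. -/
theorem isUnit_algebraMap [Algebra.IsEpi D E] (hc : ConductorFree D E) {y : D} (hy : y ≠ 0) :
    IsUnit (algebraMap D E y) := by
  have h := addIdeal_maximalIdeal_eq_top (E := E) hc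
  obtain ⟨t, ht⟩ := exists_notMem_range (D := D) (E := E)
  obtain ⟨x, hx⟩ := (mem_range_or_inv h t).resolve_left ht
  obtain ⟨a, e, he⟩ := exists_eq_add_mul hc hy t
  have hxm : ¬ IsUnit x := fun hu => by
    obtain ⟨w, hw⟩ := hu.exists_left_inv
    refine ht ⟨w, ?_⟩
    have hw' := congrArg (algebraMap D E) hw
    rw [map_mul, map_one] at hw'
    linear_combination t * hw' - algebraMap D E w * hx
  have hu : IsUnit (1 - a * x) := by
    by_contra hu
    refine (maximalIdeal.isMaximal D).ne_top ((Ideal.eq_top_iff_one _).mpr ?_)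
    simpa using add_mem ((mem_maximalIdeal _).mpr hu)
      (Ideal.mul_mem_left _ a ((mem_maximalIdeal _).mpr hxm))
  have htu : IsUnit t := .of_mul_eq_one_right _ hx
  have : algebraMap D E y * e = algebraMap D E (1 - a * x) * t := by
    simp only [map_sub, map_one, map_mul]
    linear_combination -he + algebraMap D E a * hx
  exact isUnit_of_mul_isUnit_left (this ▸ (hu.map (algebraMap D E)).mul htu)

theorem isFractionRing_of_conductorFree [Algebra.IsEpi D E]
    (hinj : Function.Injective (algebraMap D E)) (hc : ConductorFree D E) :
    IsFractionRing D E := by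
  have := nontrivial_of_isSimpleOrder D E
  have := isDomain_of_conductorFree hc
  refine ⟨?_, ?_, ?_⟩
  · rintro ⟨y, hy⟩
    exact isUnit_algebraMap hc (nonZeroDivisors.ne_zero hy)
  · intro t
    obtain ⟨a, rfl⟩ | ⟨x, hx⟩ := mem_range_or_inv (addIdeal_maximalIdeal_eq_top (E := E) hc) t
    · exact ⟨(a, 1), by simp⟩
    · refine ⟨(1, ⟨x, mem_nonZeroDivisors_of_ne_zero ?_⟩), by rw [mul_comm, hx, map_one]⟩
      rintro rfl
      simp at hx
  · intro x y hxy
    exact ⟨1, by rw [hinj hxy]⟩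

theorem valuationRing_of_conductorFree [IsDomain D] [Algebra.IsEpi D E]
    (hinj : Function.Injective (algebraMap D E)) (hc : ConductorFree D E) : ValuationRing D := by
  refine { cond' := fun a b => ?_ }
  by_cases hb : b = 0
  · exact ⟨0, Or.inl (by rw [hb, mul_zero])⟩
  obtain ⟨w, hw⟩ := (isUnit_algebraMap (E := E) hc hb).exists_left_inv
  obtain ⟨d, hd⟩ | ⟨x, hx⟩ := mem_range_or_inv (addIdeal_maximalIdeal_eq_top (E := E) hc)
    (algebraMap D E a * w)
  · refine ⟨d, Or.inr (hinj ?_)⟩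
    rw [map_mul, hd]
    linear_combination algebraMap D E a * hw
  · refine ⟨x, Or.inl (hinj ?_)⟩
    rw [map_mul]
    linear_combination algebraMap D E b * hx - algebraMap D E a * algebraMap D E x * hw

theorem ringKrullDim_eq_one_of_conductorFree [IsDomain D] [Algebra.IsEpi D E]
    (hinj : Function.Injective (algebraMap D E)) (hc : ConductorFree D E) :
    ringKrullDim D = 1 := by
  refine ringKrullDim_eq_one_iff_of_isLocalRing_isDomain.mpr
    ⟨not_isField_of_isEpi (E := E), fun y hy z hz => ?_⟩
  obtain rfl | hz0 := eq_or_ne z 0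
  · exact zero_mem _
  obtain ⟨w, hw⟩ := (isUnit_algebraMap (E := E) hc hz0).exists_left_inv
  obtain ⟨y', hy'⟩ := (isUnit_algebraMap (E := E) hc hy).exists_left_inv
  -- `w = 1/z` is not in `D`, so `E = D[1/z]`. Hence `1/y = d/z^n` for some `d` and `n`, that is,
  -- `z^n ∈ (y)`.
  have htop : Algebra.adjoin D {w} = ⊤ := by
    refine (eq_bot_or_eq_top _).resolve_left fun hb => ?_
    obtain ⟨x, hx⟩ := Algebra.mem_bot.mp (hb ▸ Algebra.self_mem_adjoin_singleton D w)
    refine (mem_maximalIdeal _).mp hz (.of_mul_eq_one_right x (hinj ?_))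
    rw [map_mul, hx, hw, map_one]
  have key : ∀ e ∈ Algebra.adjoin D {w}, ∃ n : ℕ,
      algebraMap D E z ^ n * e ∈ (algebraMap D E).range := by
    intro e he
    induction he using Algebra.adjoin_induction with
    | mem e he =>
      rw [Set.mem_singleton_iff.mp he]
      exact ⟨1, 1, by rw [pow_one, mul_comm, hw, map_one]⟩
    | algebraMap r => exact ⟨0, r, by simp⟩
    | add e e' _ _ h h' =>
      obtain ⟨n, a, ha⟩ := h
      obtain ⟨m, b, hb⟩ := h'
      refine ⟨n + m, z ^ m * a + z ^ n * b, ?_⟩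
      simp only [map_add, map_mul, map_pow, ha, hb]
      ring
    | mul e e' _ _ h h' =>
      obtain ⟨n, a, ha⟩ := h
      obtain ⟨m, b, hb⟩ := h'
      refine ⟨n + m, a * b, ?_⟩
      simp only [map_mul, ha, hb]
      ring
  obtain ⟨n, d, hd⟩ := key y' (htop ▸ Algebra.mem_top)
  refine ⟨n, Ideal.mem_span_singleton'.mpr ⟨d, hinj ?_⟩⟩
  rw [map_mul, hd, map_pow]
  linear_combination algebraMap D E z ^ n * hy'

end LocalDomain

/-! ### Passing to and from the quotient by the conductor -/

section Epimorphism

variable {A : Type u} {B : Type v} [CommRing A] [CommRing B]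

theorem IsEpimorphism.isEpi [Algebra A B] (h : IsEpimorphism (algebraMap A B)) :
    Algebra.IsEpi A B := by
  refine (Algebra.isEpi_iff_forall_one_tmul_eq A B).mpr fun b => ?_
  have := h (B ⊗[A] B) (Algebra.TensorProduct.includeRight : B →ₐ[A] B ⊗[A] B).toRingHom
    (Algebra.TensorProduct.includeLeft : B →ₐ[A] B ⊗[A] B).toRingHom (by ext x; simp)
  exact RingHom.congr_fun this b

theorem conductor_le_range (g : A →+* B) {b : B} (hb : b ∈ conductor g) : b ∈ g.range := by
  simpa using hb 1

theorem conductorQuotientHom_mk (g : A →+* B) (a : A) :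
    conductorQuotientHom g (Ideal.Quotient.mk _ a) = Ideal.Quotient.mk _ (g a) :=
  Ideal.quotientMap_mk

theorem conductorQuotientHom_injective (g : A →+* B) :
    Function.Injective (conductorQuotientHom g) :=
  Ideal.quotientMap_injective

theorem mk_mem_range_iff (g : A →+* B) (b : B) :
    Ideal.Quotient.mk (conductor g) b ∈ (conductorQuotientHom g).range ↔ b ∈ g.range := by
  constructor
  · rintro ⟨d, hd⟩
    obtain ⟨a, rfl⟩ := Ideal.Quotient.mk_surjective d
    rw [conductorQuotientHom_mk, Ideal.Quotient.eq] at hd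
    have := sub_mem (g.mem_range_self a) (conductor_le_range g hd)
    rwa [sub_sub_cancel] at this
  · rintro ⟨a, rfl⟩
    exact ⟨Ideal.Quotient.mk _ a, conductorQuotientHom_mk g a⟩

/-- A local ring map without proper intermediate rings which is an epimorphism becomes, modulo
its conductor, the inclusion of a one-dimensional valuation ring into its quotient field. -/
theorem IsEpimorphism.conductorQuotient [IsLocalRing A] {g : A →+* B}
    (hsurj : ¬ Function.Surjective g)
    (hmin : ∀ S : Subring B, g.range ≤ S → S ≤ g.range ∨ S = ⊤) (hepi : IsEpimorphism g) :
    IsOneDimValuationRing (A ⧸ conductorBelow g) ∧ IsQuotientField (conductorQuotientHom g) := by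
  let : Algebra (A ⧸ conductorBelow g) (B ⧸ conductor g) := (conductorQuotientHom g).toAlgebra
  have halg : algebraMap (A ⧸ conductorBelow g) (B ⧸ conductor g) = conductorQuotientHom g := rfl
  have hinj : Function.Injective (algebraMap (A ⧸ conductorBelow g) (B ⧸ conductor g)) :=
    conductorQuotientHom_injective g
  have : IsSimpleOrder (Subalgebra (A ⧸ conductorBelow g) (B ⧸ conductor g)) :=
    { exists_pair_ne := by
        refine ⟨⊥, ⊤, fun h => hsurj fun b => ?_⟩
        exact (mk_mem_range_iff g b).mp (Algebra.mem_bot.mp (h ▸ Algebra.mem_top))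
      eq_bot_or_eq_top := fun S => by
        have hle : g.range ≤ S.toSubring.comap (Ideal.Quotient.mk (conductor g)) := by
          rintro _ ⟨a, rfl⟩
          have := S.algebraMap_mem (Ideal.Quotient.mk _ a)
          rwa [halg, conductorQuotientHom_mk] at this
        refine (hmin _ hle).imp (fun h => ?_) fun h => ?_
        · refine eq_bot_iff.mpr fun e he => ?_
          obtain ⟨b, rfl⟩ := Ideal.Quotient.mk_surjective e
          exact Algebra.mem_bot.mpr ((mk_mem_range_iff g b).mpr (h he))
        · refine Algebra.eq_top_iff.mpr fun e => ?_
          obtain ⟨b, rfl⟩ := Ideal.Quotient.mk_surjective e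
          exact (h ▸ Subring.mem_top b :
            b ∈ S.toSubring.comap (Ideal.Quotient.mk (conductor g))) }
  have hc : ConductorFree (A ⧸ conductorBelow g) (B ⧸ conductor g) := by
    intro x hx
    obtain ⟨a, rfl⟩ := Ideal.Quotient.mk_surjective x
    refine Ideal.Quotient.eq_zero_iff_mem.mpr fun b => ?_
    have := hx (Ideal.Quotient.mk _ b)
    rw [halg, conductorQuotientHom_mk, ← map_mul] at this
    exact (mk_mem_range_iff g _).mp this
  have : Algebra.IsEpi (A ⧸ conductorBelow g) (B ⧸ conductor g) := by
    refine IsEpimorphism.isEpi fun S _ φ ψ h => ?_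
    refine Ideal.Quotient.ringHom_ext (hepi S _ _ (RingHom.ext fun a => ?_))
    have := RingHom.congr_fun h (Ideal.Quotient.mk _ a)
    simpa only [RingHom.comp_apply, halg, conductorQuotientHom_mk] using this
  have := isDomain_of_conductorFree hc
  have : IsLocalRing (A ⧸ conductorBelow g) :=
    .of_surjective' (Ideal.Quotient.mk _) Ideal.Quotient.mk_surjective
  exact ⟨⟨⟨inferInstance, valuationRing_of_conductorFree hinj hc⟩,
    ringKrullDim_eq_one_of_conductorFree hinj hc⟩, inferInstance,
    isFractionRing_of_conductorFree hinj hc⟩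

/-- An inverse modulo the conductor lifts to `b` with `g x * b = 1 + c`, where `c` comes from a
proper ideal of the local ring `A`; so `1 + c` is a unit. -/
theorem isUnit_of_notMem_conductorBelow [IsLocalRing A] {g : A →+* B}
    (h : IsQuotientField (conductorQuotientHom g)) {x : A} (hx : x ∉ conductorBelow g) :
    IsUnit (g x) := by
  let : Algebra (A ⧸ conductorBelow g) (B ⧸ conductor g) := (conductorQuotientHom g).toAlgebra
  obtain ⟨hD, hE⟩ := h
  have hu : IsUnit (conductorQuotientHom g (Ideal.Quotient.mk _ x)) :=
    IsLocalization.map_units (B ⧸ conductor g)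
      (⟨_, mem_nonZeroDivisors_of_ne_zero (mt Ideal.Quotient.eq_zero_iff_mem.mp hx)⟩ :
        nonZeroDivisors (A ⧸ conductorBelow g))
  rw [conductorQuotientHom_mk] at hu
  obtain ⟨e, he⟩ := hu.exists_right_inv
  obtain ⟨b, rfl⟩ := Ideal.Quotient.mk_surjective e
  rw [← map_mul, ← map_one (Ideal.Quotient.mk (conductor g)), Ideal.Quotient.eq] at he
  obtain ⟨c, hc⟩ := conductor_le_range g he
  have hcm : c ∈ conductorBelow g := by
    change g c ∈ conductor g
    rwa [hc]
  have hne : conductorBelow g ≠ ⊤ := fun htop => hx (htop ▸ Submodule.mem_top)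
  have hcu : IsUnit (1 + c) := by
    by_contra hcu
    refine (IsLocalRing.maximalIdeal.isMaximal A).ne_top ((Ideal.eq_top_iff_one _).mpr ?_)
    simpa using sub_mem ((IsLocalRing.mem_maximalIdeal _).mpr hcu)
      (IsLocalRing.le_maximalIdeal hne hcm)
  have : g x * b = g (1 + c) := by rw [map_add, map_one, hc]; ring
  exact isUnit_of_mul_isUnit_left (this ▸ hcu.map g)

theorem exists_mul_mem_range_of_isQuotientField {g : A →+* B}
    (h : IsQuotientField (conductorQuotientHom g)) (b : B) :
    ∃ x ∉ conductorBelow g, g x * b ∈ g.range := by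
  let : Algebra (A ⧸ conductorBelow g) (B ⧸ conductor g) := (conductorQuotientHom g).toAlgebra
  obtain ⟨hD, hE⟩ := h
  obtain ⟨⟨a, s, hs⟩, hs'⟩ := IsLocalization.surj (nonZeroDivisors (A ⧸ conductorBelow g))
    (Ideal.Quotient.mk (conductor g) b)
  obtain ⟨x, rfl⟩ := Ideal.Quotient.mk_surjective s
  refine ⟨x, mt Ideal.Quotient.eq_zero_iff_mem.mpr (nonZeroDivisors.ne_zero hs), ?_⟩
  refine (mk_mem_range_iff g _).mp ⟨a, ?_⟩
  rw [map_mul, ← conductorQuotientHom_mk, mul_comm]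
  exact hs'.symm

/-- If `B / (A : B)` is the quotient field of `A / (A : B)` and `A` is local, then `B` is the
localization of `A` at the prime ideal `(A : B)`. -/
theorem isFlatEpimorphism_of_isQuotientField [IsLocalRing A] {g : A →+* B}
    (hinj : Function.Injective g) (h : IsQuotientField (conductorQuotientHom g)) :
    IsFlatEpimorphism g := by
  have hD := h.1
  have hp : (conductorBelow g).IsPrime := (Ideal.Quotient.isDomain_iff_prime _).mp hD
  let : Algebra A B := g.toAlgebra
  have hloc : IsLocalization (conductorBelow g).primeCompl B := by
    refine ⟨fun x => isUnit_of_notMem_conductorBelow h x.2, fun b => ?_, fun {x y} hxy => ?_⟩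
    · obtain ⟨x, hx, a, ha⟩ := exists_mul_mem_range_of_isQuotientField h b
      exact ⟨(a, ⟨x, hx⟩), by rw [mul_comm]; exact ha.symm⟩
    · exact ⟨1, by rw [hinj hxy]⟩
  exact ⟨IsLocalization.flat B (conductorBelow g).primeCompl,
    fun S _ φ ψ hφ => IsLocalization.ringHom_ext (conductorBelow g).primeCompl hφ⟩

end Epimorphism

/-! ### Localizing at maximal ideals of the source -/

section Localization

variable {R : Type u} {T : Type v} [CommRing R] [CommRing T] {f : R →+* T}

theorem IsMinimal.le_range_or_eq_top (hf : IsMinimal f) (S : Subring T) (hS : f.range ≤ S) :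
    S ≤ f.range ∨ S = ⊤ := by
  refine (hf.factor S (f.codRestrict S fun r => hS ⟨r, rfl⟩) S.subtype
    Subtype.val_injective rfl).symm.imp (fun h t ht => ?_) fun h => ?_
  · obtain ⟨r, hr⟩ := h.2 ⟨t, ht⟩
    exact ⟨r, congrArg Subtype.val hr⟩
  · refine eq_top_iff.mpr fun t _ => ?_
    obtain ⟨s, rfl⟩ := h.2 t
    exact s.2

theorem localizedHom_algebraMap (J : Ideal R) [J.IsPrime] (r : R) :
    localizedHom f J (algebraMap R _ r) = algebraMap T _ (f r) :=
  IsLocalization.map_eq J.primeCompl.le_comap_map r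

theorem localizedHom_comp (J : Ideal R) [J.IsPrime] :
    (localizedHom f J).comp (algebraMap R _) = (algebraMap T (TLocalization f J)).comp f :=
  RingHom.ext (localizedHom_algebraMap J)

theorem localizedHom_injective (hf : Function.Injective f) (J : Ideal R) [J.IsPrime] :
    Function.Injective (localizedHom f J) :=
  IsLocalization.map_injective_of_injective _ _ _ hf

theorem exists_mul_eq_algebraMap {J : Ideal R} [J.IsPrime] (b : TLocalization f J) :
    ∃ (t : T) (s : R), s ∉ J ∧ b * algebraMap T _ (f s) = algebraMap T _ t := by
  obtain ⟨⟨t, _, s, hs, rfl⟩, h⟩ := IsLocalization.surj (J.primeCompl.map f) b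
  exact ⟨t, s, hs, h⟩

theorem exists_mul_eq_mul_of_algebraMap_eq {J : Ideal R} [J.IsPrime] {t t' : T}
    (h : algebraMap T (TLocalization f J) t = algebraMap T _ t') :
    ∃ s ∉ J, f s * t = f s * t' := by
  obtain ⟨⟨_, s, hs, rfl⟩, h⟩ := (IsLocalization.eq_iff_exists (J.primeCompl.map f) _).mp h
  exact ⟨s, hs, h⟩

theorem mem_range_of_mul_mem_range {J : Ideal R} [J.IsPrime] {b : TLocalization f J} {s : R}
    (hs : s ∉ J) (h : b * algebraMap T _ (f s) ∈ (localizedHom f J).range) :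
    b ∈ (localizedHom f J).range := by
  obtain ⟨a, ha⟩ := h
  obtain ⟨w, hw⟩ := (IsLocalization.map_units (Localization.AtPrime J)
    (⟨s, hs⟩ : J.primeCompl)).exists_right_inv
  refine ⟨a * w, ?_⟩
  have hw' := congrArg (localizedHom f J) hw
  rw [map_mul, map_one, localizedHom_algebraMap] at hw'
  rw [map_mul, ha]
  linear_combination b * hw'

theorem algebraMap_mem_range_iff {J : Ideal R} [J.IsPrime] {t : T} :
    algebraMap T (TLocalization f J) t ∈ (localizedHom f J).range ↔
      ∃ s ∉ J, f s * t ∈ f.range := by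
  constructor
  · rintro ⟨a, ha⟩
    obtain ⟨⟨r, s, hs⟩, h⟩ := IsLocalization.surj J.primeCompl a
    have h' := congrArg (localizedHom f J) h
    simp only [map_mul, localizedHom_algebraMap, ha] at h'
    rw [← map_mul] at h'
    obtain ⟨c, hc, hcs⟩ := exists_mul_eq_mul_of_algebraMap_eq h'
    refine ⟨c * s, J.primeCompl.mul_mem hc hs, c * r, ?_⟩
    rw [map_mul, map_mul]
    linear_combination -hcs
  · rintro ⟨s, hs, r, hr⟩
    refine mem_range_of_mul_mem_range hs ⟨algebraMap R _ r, ?_⟩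
    rw [localizedHom_algebraMap, hr, map_mul, mul_comm]

theorem IsMinimal.localizedHom_le_range_or_eq_top (hf : IsMinimal f) (J : Ideal R) [J.IsPrime]
    (S : Subring (TLocalization f J)) (hS : (localizedHom f J).range ≤ S) :
    S ≤ (localizedHom f J).range ∨ S = ⊤ := by
  have hle : f.range ≤ S.comap (algebraMap T _) := by
    rintro _ ⟨r, rfl⟩
    exact hS ⟨algebraMap R _ r, localizedHom_algebraMap J r⟩
  refine (hf.le_range_or_eq_top _ hle).imp (fun h b hb => ?_) fun h => eq_top_iff.mpr fun b _ => ?_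
  · obtain ⟨t, s, hs, hb'⟩ := exists_mul_eq_algebraMap b
    have ht : algebraMap T _ t ∈ S :=
      hb' ▸ mul_mem hb (hS ⟨algebraMap R _ s, localizedHom_algebraMap J s⟩)
    obtain ⟨r, rfl⟩ := h ht
    exact mem_range_of_mul_mem_range hs ⟨algebraMap R _ r, by
      rw [localizedHom_algebraMap, hb']⟩
  · obtain ⟨t, s, hs, hb'⟩ := exists_mul_eq_algebraMap b
    have ht : algebraMap T _ t ∈ S := (h ▸ Subring.mem_top t : t ∈ S.comap (algebraMap T _))
    obtain ⟨w, hw⟩ := (IsLocalization.map_units (Localization.AtPrime J)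
      (⟨s, hs⟩ : J.primeCompl)).exists_right_inv
    have hw' := congrArg (localizedHom f J) hw
    rw [map_mul, map_one, localizedHom_algebraMap] at hw'
    have : b = algebraMap T _ t * localizedHom f J w := by
      linear_combination localizedHom f J w * hb' - b * hw'
    rw [this]
    exact mul_mem ht (hS ⟨w, rfl⟩)

theorem IsCrucial.not_surjective (hf : Function.Injective f) {J : Ideal R} [J.IsMaximal]
    (hJ : IsCrucial f J) : ¬ Function.Surjective (localizedHom f J) :=
  fun h => hJ ⟨localizedHom_injective hf J, h⟩

/-- `R` is the preimage of `R_J` in `T` when `J` is crucial. -/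
theorem IsCrucial.mem_range_of_mul_mem_range (hf : IsMinimal f) {J : Ideal R} [J.IsMaximal]
    (hJ : IsCrucial f J) {s : R} (hs : s ∉ J) {t : T} (h : f s * t ∈ f.range) : t ∈ f.range := by
  -- The preimage of `R_J` in `T` is an intermediate ring. It is not `T`, since `R_J → T_J` is not
  -- surjective.
  have hle : f.range ≤ (localizedHom f J).range.comap (algebraMap T _) := by
    rintro _ ⟨r, rfl⟩
    exact ⟨algebraMap R _ r, localizedHom_algebraMap J r⟩
  refine (hf.le_range_or_eq_top _ hle).resolve_right (fun htop => ?_)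
    (algebraMap_mem_range_iff.mpr ⟨s, hs, h⟩ : _ ∈ (localizedHom f J).range)
  refine hJ.not_surjective hf.injective fun b => ?_
  obtain ⟨t, s, hs, hb⟩ := exists_mul_eq_algebraMap b
  refine MinimalRingHom.mem_range_of_mul_mem_range hs (hb ▸ ?_)
  exact (htop ▸ Subring.mem_top t : t ∈ (localizedHom f J).range.comap (algebraMap T _))

/-- Uniqueness of the crucial maximal ideal, when `T_J / (R_J : T_J)` is the quotient field of
`R_J / (R_J : T_J)`. -/
theorem IsCrucial.eq_of_isQuotientField (hf : IsMinimal f) {J : Ideal R} [J.IsMaximal]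
    (hJ : IsCrucial f J) (h : IsQuotientField (conductorQuotientHom (localizedHom f J)))
    {J' : Ideal R} [hJ'max : J'.IsMaximal] (hJ' : IsCrucial f J') : J = J' := by
  by_contra hne
  obtain ⟨x, hx, hx'⟩ : ∃ x ∈ J, x ∉ J' := by
    by_contra! hle
    exact hne (Ideal.IsMaximal.eq_of_le inferInstance hJ'max.ne_top hle)
  have hxt {t : T} (ht : f x * t ∈ f.range) : t ∈ f.range :=
    hJ'.mem_range_of_mul_mem_range hf hx' ht
  by_cases hxC : algebraMap R (Localization.AtPrime J) x ∈ conductorBelow (localizedHom f J)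
  -- Here `xT` lies in `R_J`, hence in `R`, and cancelling `x ∉ J'` gives `T = R`.
  · refine hf.not_bijective ⟨hf.injective, fun t => hxt ?_⟩
    have := hxC (algebraMap T _ t)
    rw [localizedHom_algebraMap, ← map_mul, algebraMap_mem_range_iff] at this
    obtain ⟨s, hs, hst⟩ := this
    exact hJ.mem_range_of_mul_mem_range hf hs hst
  -- Here `x` is a unit of `T_J`. Writing its inverse as `t/s` gives `cxt = cs` with `c ∉ J`;
  -- cancelling `x` puts `r = ct` in `R`, so `xr = cs` lies in `J`, although `c` and `s` do not.
  · obtain ⟨b, hb⟩ := (isUnit_of_notMem_conductorBelow h hxC).exists_right_inv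
    rw [localizedHom_algebraMap] at hb
    obtain ⟨t, s, hs, hbt⟩ := exists_mul_eq_algebraMap b
    have key : algebraMap T (TLocalization f J) (f x * t) = algebraMap T _ (f s) := by
      rw [map_mul]
      linear_combination algebraMap T (TLocalization f J) (f s) * hb -
        algebraMap T (TLocalization f J) (f x) * hbt
    obtain ⟨c, hc, hcs⟩ := exists_mul_eq_mul_of_algebraMap_eq key
    obtain ⟨r, hr⟩ : f c * t ∈ f.range :=
      hxt ⟨c * s, by rw [map_mul]; linear_combination -hcs⟩
    have hmem : x * r = c * s := hf.injective (by
      rw [map_mul, map_mul, hr]; linear_combination hcs)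
    exact J.primeCompl.mul_mem hc hs (hmem ▸ J.mul_mem_right r hx)

theorem IsEpimorphism.localizedHom (h : IsEpimorphism f) (J : Ideal R) [J.IsPrime] :
    IsEpimorphism (localizedHom f J) := by
  intro S _ φ ψ hφ
  refine IsLocalization.ringHom_ext (J.primeCompl.map f) (h S _ _ ?_)
  rw [RingHom.comp_assoc, RingHom.comp_assoc, ← localizedHom_comp, ← RingHom.comp_assoc, hφ,
    RingHom.comp_assoc]

/-- Being a flat epimorphism can be checked at the maximal ideals of the source. -/
theorem isFlatEpimorphism_of_localizedHom
    (h : ∀ (J : Ideal R) [J.IsMaximal], IsFlatEpimorphism (localizedHom f J)) :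
    IsFlatEpimorphism f := by
  constructor
  · let : Algebra R T := f.toAlgebra
    have (P : Ideal R) [P.IsMaximal] :
        IsLocalization (Algebra.algebraMapSubmonoid T P.primeCompl) (TLocalization f P) :=
      inferInstanceAs (IsLocalization (P.primeCompl.map f) (TLocalization f P))
    have (P : Ideal R) [P.IsMaximal] : IsLocalizedModule.AtPrime P
        (IsScalarTower.toAlgHom R T (TLocalization f P)).toLinearMap :=
      (isLocalizedModule_iff_isLocalization (S := P.primeCompl)).mpr inferInstance
    refine @Module.flat_of_isLocalized_maximal R R _ _ _ T _ _ _ _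
      (fun P _ => TLocalization f P) _ _ _ _
      (fun P _ => (IsScalarTower.toAlgHom R T (TLocalization f P)).toLinearMap) this fun P _ => ?_
    have hflat : ((localizedHom f P).comp (algebraMap R _)).Flat :=
      RingHom.Flat.comp (RingHom.flat_algebraMap_iff.mpr
        (IsLocalization.flat (Localization.AtPrime P) P.primeCompl)) (h P).1
    rw [localizedHom_comp] at hflat
    exact RingHom.flat_algebraMap_iff.mp hflat
  · intro S _ φ ψ hφ
    refine RingHom.ext fun t => ?_
    by_contra hne
    -- `I` is the annihilator of `φ t - ψ t` in `R`. If proper, it lies in some maximal `J`, yet `φ`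
    -- and `ψ` agree after localizing at `J`, so some `s ∉ J` lies in `I`.
    let I : Ideal R := ((⊥ : Ideal S).colon {φ t - ψ t}).comap (φ.comp f)
    have hI {r : R} : r ∈ I ↔ φ (f r) * (φ t - ψ t) = 0 := by
      simp [I, Submodule.mem_colon_singleton]
    obtain ⟨J, hJ, hIJ⟩ := I.exists_le_maximal fun htop => hne <| sub_eq_zero.mp <| by
      simpa using hI.mp (htop ▸ Submodule.mem_top : (1 : R) ∈ I)
    let N : Submonoid S := J.primeCompl.map (φ.comp f)
    have hφN : J.primeCompl.map f ≤ N.comap φ := by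
      rintro _ ⟨s, hs, rfl⟩
      exact ⟨s, hs, rfl⟩
    have hψN : J.primeCompl.map f ≤ N.comap ψ := by
      rintro _ ⟨s, hs, rfl⟩
      exact ⟨s, hs, RingHom.congr_fun hφ s⟩
    let φ' : TLocalization f J →+* Localization N :=
      IsLocalization.map (Localization N) φ hφN
    let ψ' : TLocalization f J →+* Localization N :=
      IsLocalization.map (Localization N) ψ hψN
    have heq : φ' = ψ' := by
      refine (h J).2 _ _ _ (IsLocalization.ringHom_ext J.primeCompl (RingHom.ext fun r => ?_))
      have hr : φ (f r) = ψ (f r) := RingHom.congr_fun hφ r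
      simp only [RingHom.comp_apply, localizedHom_algebraMap, φ', ψ', IsLocalization.map_eq, hr]
    have ht := RingHom.congr_fun heq (algebraMap T _ t)
    simp only [φ', ψ', IsLocalization.map_eq] at ht
    obtain ⟨⟨_, s, hs, rfl⟩, hst⟩ := (IsLocalization.eq_iff_exists N _).mp ht
    refine hs (hIJ (hI.mpr ?_))
    rw [mul_sub]
    exact sub_eq_zero.mpr hst

theorem isFlatEpimorphism_of_bijective (hf : Function.Bijective f) : IsFlatEpimorphism f :=
  ⟨.of_bijective hf, fun _ _ _ _ h => (RingHom.cancel_right hf.2).mp h⟩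

end Localization

end MinimalRingHom

theorem theorem3p6 {R : Type u} {T : Type v} [CommRing R] [CommRing T] (f : R →+* T)
    (hf : MinimalRingHom.IsMinimal f) (J : Ideal R) [J.IsMaximal]
    (hJ : MinimalRingHom.IsCrucial f J) :
    MinimalRingHom.IsFlatEpimorphism f ↔
      MinimalRingHom.IsOneDimValuationRing
          (Localization.AtPrime J ⧸
            MinimalRingHom.conductorBelow (MinimalRingHom.localizedHom f J)) ∧
        MinimalRingHom.IsQuotientField
          (MinimalRingHom.conductorQuotientHom (MinimalRingHom.localizedHom f J)) := by
  constructor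
  · rintro ⟨-, hepi⟩
    exact (hepi.localizedHom J).conductorQuotient (hJ.not_surjective hf.injective)
      (hf.localizedHom_le_range_or_eq_top J)
  · rintro ⟨-, hq⟩
    refine MinimalRingHom.isFlatEpimorphism_of_localizedHom fun J' _ => ?_
    by_cases hJ' : MinimalRingHom.IsCrucial f J'
    · obtain rfl := hJ.eq_of_isQuotientField hf hq hJ'
      exact MinimalRingHom.isFlatEpimorphism_of_isQuotientField
        (MinimalRingHom.localizedHom_injective hf.injective J) hq
    · exact MinimalRingHom.isFlatEpimorphism_of_bijective (not_not.mp hJ')
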